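/- Let $\epsilon_0\ge 0$ and $\lambda\ge 2$. There is an integer $N$, depending only on $\epsilon_0$ and $\lambda$, such that for every $n\ge N$ every shuffled $\epsilon_0$-LDP adaptive process on $n$ records satisfies $\left(\lambda,\ \frac{2e^{\epsilon_0}\lambda}{n-1}\right)$-RDP. Here an $\epsilon_0$-LDP adaptive process on $n$ records from a domain $\mathcal D$ consists of measurable spaces $\mathcal S^{(1)},\dots,\mathcal S^{(n)}$ and of randomized algorithms $\mathcal R^{(i)}:\mathcal S^{(1)}\times\cdots\times\mathcal S^{(i-1)}\times\mathcal D\to\mathcal S^{(i)}$, $1\le i\le n$ (for each $x\in\mathcal D$, $\mathcal R^{(i)}(\cdot,x)$ is a Markov kernel), such that $$\mathbb P(\mathcal R^{(i)}(z_{1:i-1},x)\in E)\le e^{\epsilon_0}\,\mathbb P(\mathcal R^{(i)}(z_{1:i-1},x')\in E)$$ for all $i$, all $z_{1:i-1}$, all $x,x'\in\mathcal D$ and all measurable $E\subseteq \mathcal S^{(i)}$. On a dataset $(x_1,\dots,x_n)\in\mathcal D^n$ the shuffled process draws a uniformly random permutation $\pi$ of $\{1,\dots,n\}$, computes successively $z_i=\mathcal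 R^{(i)}(z_{1:i-1},x_{\pi(i)})$ for $i=1,\dots,n$, and outputs $z_{1:n}$. A mechanism $\mathcal M$ is $(\lambda,\epsilon)$-RDP if $D^\lambda(\mathcal M(X)\|\mathcal M(Y))\le\epsilon$ for all datasets $X,Y$ that differ in exactly one record, where for laws $U,V$ $$D^\lambda(U\|V)=\frac1{\lambda-1}\log \mathbb E_{x\sim V}\left[\left(\frac{dU}{dV}(x)\right)^{\lambda}\right],$$ with the value $+\infty$ if $U$ is not absolutely continuous with respect to $V$. -/

import Mathlib

open MeasureTheory ProbabilityTheory Filter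
open scoped ENNReal

noncomputable section

/-- The Rényi divergence of order `α` of `U` from `V`, as an extended real number:
`1 / (α - 1) * log E_{x ∼ V} [(dU/dV (x)) ^ α]` when `U ≪ V`, and `+∞` otherwise. -/
def renyiDivergence {Ω : Type*} [MeasurableSpace Ω] (α : ℝ) (U V : Measure Ω) : EReal :=
  open Classical in
  if U ≪ V then
    (((α - 1)⁻¹ : ℝ) : EReal) * ENNReal.log (∫⁻ ω, (U.rnDeriv V ω) ^ α ∂V)
  else ⊤

/-- Two datasets are neighbouring if they differ in exactly one record. -/
def Neighbouring {n : ℕ} {D : Type*} (X Y : Fin n → D) : Prop :=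
  ∃ i, X i ≠ Y i ∧ ∀ j, j ≠ i → X j = Y j

/-- `(α, ε)`-Rényi differential privacy of the mechanism on datasets of size `n`
which sends the dataset `X` to a random element of `Ω` with law `M X`. -/
def IsRDP {n : ℕ} {D Ω : Type*} [MeasurableSpace Ω] (α ε : ℝ)
    (M : (Fin n → D) → Measure Ω) : Prop :=
  ∀ X Y : Fin n → D, Neighbouring X Y → renyiDivergence α (M X) (M Y) ≤ (ε : EReal)

/-- `ε`-local differential privacy of the randomizer on single records
which sends the record `x` to a random element of `Ω` with law `M x`. -/
def IsLDP {D Ω : Type*} [MeasurableSpace Ω] (ε : ℝ) (M : D → Measure Ω) : Prop :=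
  ∀ (x y : D) (s : Set Ω), MeasurableSet s →
    M x s ≤ ENNReal.ofReal (Real.exp ε) * M y s

/-- An adaptive process on `n` records from `D` with range spaces `S 0, …, S (n - 1)`: for every
step `i` and every record `x`, a Markov kernel that turns the outputs of the steps before `i`
into the law of the output of step `i`. -/
structure AdaptiveProcess (n : ℕ) (D : Type*) (S : Fin n → Type*)
    [∀ i, MeasurableSpace (S i)] where
  /-- the randomizer of step `i` -/
  randomizer (i : Fin n) (x : D) :
    Kernel (∀ j : Fin i, S (j.castLE i.isLt.le)) (S i)
  isMarkov (i : Fin n) (x : D) : IsMarkovKernel (randomizer i x)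

namespace AdaptiveProcess

variable {n : ℕ} {D : Type*} {S : Fin n → Type*} [∀ i, MeasurableSpace (S i)]

/-- Every randomizer of the process is `ε`-LDP, for all values of the auxiliary inputs. -/
def IsLocallyDP (R : AdaptiveProcess n D S) (ε : ℝ) : Prop :=
  ∀ (i : Fin n) (z : ∀ j : Fin i, S (j.castLE i.isLt.le)),
    IsLDP ε (fun x => R.randomizer i x z)

/-- The joint law of the first `k` outputs when step `i` is run on the record `X i`. -/
def partialLaw (R : AdaptiveProcess n D S) (X : Fin n → D) :
    (k : ℕ) → (hk : k ≤ n) → Measure (∀ j : Fin k, S (j.castLE hk))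
  | 0, _ => Measure.dirac (fun j => j.elim0)
  | k + 1, hk =>
      (partialLaw R X k (Nat.le_of_succ_le hk) ⊗ₘ R.randomizer ⟨k, hk⟩ (X ⟨k, hk⟩)).map
        (fun p => Fin.snoc (α := fun j : Fin (k + 1) => S (j.castLE hk)) p.1 p.2)

/-- The law of the output `(z₁, …, zₙ)` of the adaptive process on the dataset `X`. -/
def law (R : AdaptiveProcess n D S) (X : Fin n → D) : Measure (∀ i, S i) :=
  R.partialLaw X n le_rfl

/-- The law of the output of the shuffled process on the dataset `X`: a permutation `π` is drawn
uniformly at random, and step `i` is run on the record `X (π i)`. -/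
def shuffledLaw (R : AdaptiveProcess n D S) (X : Fin n → D) : Measure (∀ i, S i) :=
  (Fintype.card (Equiv.Perm (Fin n)) : ℝ≥0∞)⁻¹ •
    ∑ π : Equiv.Perm (Fin n), R.law (fun i => X (π i))

end AdaptiveProcess

end

/-!
Fix neighbouring datasets that differ at the record `a`. At every step the two randomizers of `a`
are the mixtures `(1 ± c) / 2 • U + (1 ∓ c) / 2 • V` of two clones `U` and `V`, where
`c = tanh (ε₀ / 2)`, and every other record uses `(U + V) / 2` with probability `r = exp (-ε₀)`.
Mark `a` and the records that use a clone, and give each marked record the sign of its clone. The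
uniform permutation hides `a` among the set `T` of marked records, so that `X` and `Y` produce
mixtures of the same laws, with weights proportional to `1 + c * η` and `1 - c * η`, where `η` is
the mean of `|T|` fair signs. By joint convexity the Rényi moment is at most
`E[(1 + c * η) ^ α * (1 - c * η) ^ (1 - α)]`; its linear term vanishes, its quadratic term is
`2 * α * (α - 1) * c ^ 2 * E[η ^ 2]`, and `E[η ^ 2] = E[1 / |T|] ≤ 1 / (n * r)` since `|T| - 1` is
binomial. The factor `c ^ 2 < 1` leaves the room that absorbs all further terms for large `n`.
-/

section Mixtures

variable {Ω ι : Type*} [MeasurableSpace Ω] [Fintype ι]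

theorem sum_smul_eq_withDensity (Q : Measure Ω) (N : ι → Measure Ω) [SigmaFinite Q]
    [∀ i, SigmaFinite (N i)] (hN : ∀ i, N i ≪ Q) (ρ : ι → ℝ≥0∞) :
    ∑ i, ρ i • N i = Q.withDensity fun ω => ∑ i, ρ i * (N i).rnDeriv Q ω := by
  ext s hs
  have hmeas (i : ι) : Measurable ((N i).rnDeriv Q) := Measure.measurable_rnDeriv _ _
  simp only [withDensity_apply _ hs, lintegral_finsetSum _ fun i _ => (hmeas i).const_mul (ρ i),
    lintegral_const_mul _ (hmeas _), Measure.setLIntegral_rnDeriv (hN _), Measure.coe_finsetSum,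
    Finset.sum_apply, Measure.smul_apply, smul_eq_mul]

theorem rnDeriv_sum_smul (Q : Measure Ω) (N : ι → Measure Ω) [SigmaFinite Q]
    [∀ i, SigmaFinite (N i)] (hN : ∀ i, N i ≪ Q) (ρ : ι → ℝ≥0∞) :
    (∑ i, ρ i • N i).rnDeriv Q =ᵐ[Q] fun ω => ∑ i, ρ i * (N i).rnDeriv Q ω := by
  rw [sum_smul_eq_withDensity Q N hN]
  exact Measure.rnDeriv_withDensity Q
    (Finset.measurable_fun_sum _ fun i _ => (Measure.measurable_rnDeriv _ _).const_mul _)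

theorem absolutelyContinuous_sum (N : ι → Measure Ω) (i : ι) : N i ≪ ∑ j, N j := by
  rw [← Measure.sum_fintype]
  exact Measure.absolutelyContinuous_sum_right i .rfl

theorem sum_smul_absolutelyContinuous (N : ι → Measure Ω) (ρ : ι → ℝ≥0∞) :
    ∑ i, ρ i • N i ≪ ∑ i, N i := by
  rw [← Measure.sum_fintype (fun i => ρ i • N i)]
  exact Measure.absolutelyContinuous_sum_left fun i =>
    (Measure.smul_absolutelyContinuous).trans (absolutelyContinuous_sum N i)

theorem lintegral_rnDeriv_rpow_sum_smul_le (N : ι → Measure Ω) [∀ i, IsFiniteMeasure (N i)]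
    (ρ : ι → ℝ≥0∞) {α : ℝ} (hα : 1 ≤ α) :
    ∫⁻ ω, ((∑ i, ρ i • N i).rnDeriv (∑ i, N i) ω) ^ α ∂(∑ i, N i) ≤
      ∑ i, N i Set.univ * ρ i ^ α := by
  have hac := absolutelyContinuous_sum N
  set Q := ∑ i, N i with hQ
  have hmeas (i : ι) : Measurable ((N i).rnDeriv Q) := Measure.measurable_rnDeriv _ _
  have hsum : ∀ᵐ ω ∂Q, ∑ i, (N i).rnDeriv Q ω = 1 := by
    have h := rnDeriv_sum_smul Q N hac 1
    simp only [Pi.one_apply, one_smul, one_mul, ← hQ] at h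
    filter_upwards [h, Q.rnDeriv_self] with ω h₁ h₂
    rw [← h₁, h₂]
  calc ∫⁻ ω, ((∑ i, ρ i • N i).rnDeriv Q ω) ^ α ∂Q
      ≤ ∫⁻ ω, ∑ i, (N i).rnDeriv Q ω * ρ i ^ α ∂Q := by
        refine lintegral_mono_ae ?_
        filter_upwards [hsum, rnDeriv_sum_smul Q N hac ρ] with ω h₁ h₂
        simp only [h₂, mul_comm (ρ _)]
        exact ENNReal.rpow_arith_mean_le_arith_mean_rpow Finset.univ _ ρ h₁ hα
    _ = ∑ i, N i Set.univ * ρ i ^ α := by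
        simp only [lintegral_finsetSum _ fun i _ => (hmeas i).mul_const (ρ i ^ α),
          lintegral_mul_const _ (hmeas _), Measure.lintegral_rnDeriv (hac _)]

/-- The order-`α` moment of the likelihood ratio `(1 + u) / (1 - u)` under the weight `1 - u`. -/
noncomputable def tiltedMoment (α u : ℝ) : ℝ :=
  (1 + u) ^ α * (1 - u) ^ (1 - α)

theorem tiltedMoment_nonneg {α u : ℝ} (hu : |u| ≤ 1) : 0 ≤ tiltedMoment α u := by
  have := abs_le.1 hu
  exact mul_nonneg (Real.rpow_nonneg (by linarith) _) (Real.rpow_nonneg (by linarith) _)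

theorem div_rpow_mul_eq_tiltedMoment (α : ℝ) {u : ℝ} (hu : |u| < 1) :
    ((1 + u) / (1 - u)) ^ α * (1 - u) = tiltedMoment α u := by
  have := abs_lt.1 hu
  have hpos : 0 < 1 - u := by linarith
  rw [tiltedMoment, Real.div_rpow (by linarith) hpos.le, Real.rpow_sub hpos, Real.rpow_one]
  ring

/-- The mixture of the `M i` with weights `w i * (1 + u i)`. -/
noncomputable def tiltedMixture (w u : ι → ℝ) (M : ι → Measure Ω) : Measure Ω :=
  ∑ i, ENNReal.ofReal (w i * (1 + u i)) • M i

theorem tiltedMixture_eq_sum_smul (w : ι → ℝ) {u : ι → ℝ} (hu : ∀ i, |u i| < 1)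
    (M : ι → Measure Ω) :
    tiltedMixture w u M = ∑ i, ENNReal.ofReal ((1 + u i) / (1 - u i)) •
      ENNReal.ofReal (w i * (1 - u i)) • M i := by
  refine Finset.sum_congr rfl fun i _ => ?_
  have := abs_lt.1 (hu i)
  have hpos : 0 < 1 - u i := by linarith
  rw [smul_smul, ← ENNReal.ofReal_mul (div_nonneg (by linarith) hpos.le)]
  congr 2
  field_simp

theorem tiltedMixture_absolutelyContinuous (w : ι → ℝ) {u : ι → ℝ}
    (hu : ∀ i, |u i| < 1) (M : ι → Measure Ω) :
    tiltedMixture w u M ≪ tiltedMixture w (-u) M := by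
  rw [tiltedMixture_eq_sum_smul w hu]
  exact sum_smul_absolutelyContinuous _ _

theorem lintegral_rnDeriv_rpow_tiltedMixture_le {α : ℝ} (hα : 1 ≤ α) {w u : ι → ℝ}
    (hw : ∀ i, 0 ≤ w i) (hu : ∀ i, |u i| < 1) (M : ι → Measure Ω)
    [∀ i, IsProbabilityMeasure (M i)] :
    ∫⁻ ω, ((tiltedMixture w u M).rnDeriv (tiltedMixture w (-u) M) ω) ^ α
        ∂(tiltedMixture w (-u) M) ≤
      ENNReal.ofReal (∑ i, w i * tiltedMoment α (u i)) := by
  have (i : ι) : IsFiniteMeasure (ENNReal.ofReal (w i * (1 - u i)) • M i) :=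
    Measure.smul_finite _ ENNReal.ofReal_ne_top
  have hmix := lintegral_rnDeriv_rpow_sum_smul_le
    (fun i => ENNReal.ofReal (w i * (1 - u i)) • M i)
    (fun i => ENNReal.ofReal ((1 + u i) / (1 - u i))) hα
  rw [← tiltedMixture_eq_sum_smul w hu] at hmix
  refine hmix.trans_eq ?_
  rw [ENNReal.ofReal_sum_of_nonneg fun i _ =>
    mul_nonneg (hw i) (tiltedMoment_nonneg (hu i).le)]
  refine Finset.sum_congr rfl fun i _ => ?_
  have := abs_lt.1 (hu i)
  have hratio : 0 ≤ (1 + u i) / (1 - u i) := div_nonneg (by linarith) (by linarith)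
  rw [Measure.smul_apply, measure_univ, smul_eq_mul, mul_one,
    ENNReal.ofReal_rpow_of_nonneg hratio (by linarith),
    ← ENNReal.ofReal_mul' (Real.rpow_nonneg hratio _), mul_assoc, mul_comm (1 - u i),
    div_rpow_mul_eq_tiltedMoment α (hu i)]

end Mixtures

theorem renyiDivergence_le_of_lintegral_le {Ω : Type*} [MeasurableSpace Ω] {α ε : ℝ} (hα : 1 < α)
    {U V : Measure Ω} (hac : U ≪ V)
    (h : ∫⁻ ω, (U.rnDeriv V ω) ^ α ∂V ≤ ENNReal.ofReal (Real.exp ((α - 1) * ε))) :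
    renyiDivergence α U V ≤ (ε : EReal) := by
  have hlog := ENNReal.log_monotone h
  rw [ENNReal.log_ofReal_of_pos (Real.exp_pos _), Real.log_exp] at hlog
  have hpos : 0 < α - 1 := sub_pos.2 hα
  rw [renyiDivergence, if_pos hac]
  calc (((α - 1)⁻¹ : ℝ) : EReal) * ENNReal.log (∫⁻ ω, (U.rnDeriv V ω) ^ α ∂V)
      ≤ (((α - 1)⁻¹ : ℝ) : EReal) * (((α - 1) * ε : ℝ) : EReal) :=
        mul_le_mul_of_nonneg_left hlog (by exact_mod_cast (inv_pos.2 hpos).le)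
    _ = ε := by rw [← EReal.coe_mul, inv_mul_cancel_left₀ hpos.ne']

theorem eq_sum_ofReal_smul {Ω ι : Type*} [MeasurableSpace Ω] [Fintype ι] {μ : Measure Ω}
    {N : ι → Measure Ω} [IsFiniteMeasure μ] [∀ i, IsFiniteMeasure (N i)] {w : ι → ℝ}
    (hw : ∀ i, 0 ≤ w i) (h : ∀ s, MeasurableSet s → μ.real s = ∑ i, w i * (N i).real s) :
    μ = ∑ i, ENNReal.ofReal (w i) • N i := by
  ext s hs
  rw [← ofReal_measureReal, h s hs,
    ENNReal.ofReal_sum_of_nonneg fun i _ => mul_nonneg (hw i) measureReal_nonneg]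
  simp only [ENNReal.ofReal_mul (hw _), ofReal_measureReal (h := measure_ne_top _ _),
    Measure.coe_finsetSum, Finset.sum_apply, Measure.smul_apply, smul_eq_mul]

section Residual

variable {Z S : Type*} [MeasurableSpace Z] [MeasurableSpace S]

/-- The measure `ρ` with `E • μ = ν + (E - 1) • ρ`, when `1 < E` and `ν ≤ E • μ`. -/
noncomputable def residualMeasure (E : ℝ) (μ ν : Measure S) : Measure S :=
  ENNReal.ofReal (E - 1)⁻¹ • (ENNReal.ofReal E • μ - ν)

theorem residualMeasure_apply {E : ℝ} (hE : 1 < E) {μ ν : Measure S} [IsFiniteMeasure μ]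
    [IsFiniteMeasure ν] (h : ν ≤ ENNReal.ofReal E • μ) {s : Set S} (hs : MeasurableSet s) :
    residualMeasure E μ ν s = ENNReal.ofReal ((E - 1)⁻¹ * (E * μ.real s - ν.real s)) := by
  rw [residualMeasure, Measure.smul_apply, Measure.sub_apply hs h,
    ENNReal.ofReal_mul (inv_nonneg.2 (sub_pos.2 hE).le), ENNReal.ofReal_sub _ measureReal_nonneg,
    ENNReal.ofReal_mul (by linarith), ofReal_measureReal, ofReal_measureReal]
  rfl

theorem exists_residualKernel {E : ℝ} (hE : 1 < E) (κ η : Kernel Z S) [IsMarkovKernel κ]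
    [IsMarkovKernel η] (h : ∀ z, η z ≤ ENNReal.ofReal E • κ z) :
    ∃ ξ : Kernel Z S, IsMarkovKernel ξ ∧
      ∀ z s, MeasurableSet s → (E - 1) * (ξ z).real s = E * (κ z).real s - (η z).real s := by
  have hE' : 0 < E - 1 := sub_pos.2 hE
  let ξ : Kernel Z S :=
    { toFun z := residualMeasure E (κ z) (η z)
      measurable' := by
        refine Measure.measurable_of_measurable_coe _ fun s hs => ?_
        simp only [residualMeasure_apply hE (h _) hs]
        have hκ := (Kernel.measurable_coe κ hs).ennreal_toReal
        have hη := (Kernel.measurable_coe η hs).ennreal_toReal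
        exact (((hκ.const_mul E).sub hη).const_mul (E - 1)⁻¹).ennreal_ofReal }
  have hξ (z : Z) {s : Set S} (hs : MeasurableSet s) :
      ξ z s = ENNReal.ofReal ((E - 1)⁻¹ * (E * (κ z).real s - (η z).real s)) :=
    residualMeasure_apply hE (h z) hs
  refine ⟨ξ, ⟨fun z => ⟨?_⟩⟩, fun z s hs => ?_⟩
  · rw [hξ z .univ, probReal_univ, probReal_univ, mul_one, inv_mul_cancel₀ hE'.ne',
      ENNReal.ofReal_one]
  · have hle : (η z).real s ≤ E * (κ z).real s := by
      have := ENNReal.toReal_mono (ENNReal.mul_ne_top ENNReal.ofReal_ne_top (measure_ne_top _ _))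
        (h z s)
      rwa [ENNReal.toReal_mul,
        ENNReal.toReal_ofReal (by linarith)] at this
    rw [measureReal_def, hξ z hs, ENNReal.toReal_ofReal
      (mul_nonneg (inv_nonneg.2 hE'.le) (sub_nonneg.2 hle)), mul_inv_cancel_left₀ hE'.ne']

end Residual

/-- The sign `±1` encoded by a bit. -/
def boolSign (t : Bool) : ℝ := if t then 1 else -1

theorem one_add_mul_boolSign_nonneg {d : ℝ} (hd : |d| ≤ 1) (t : Bool) :
    0 ≤ 1 + d * boolSign t := by
  have := abs_le.1 hd
  cases t <;> simp only [boolSign, if_true, Bool.false_eq_true, if_false] <;> linarith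

/-- The bias `tanh (ε / 2)` of a randomized-response bit that is exactly `ε`-LDP. -/
noncomputable def signBias (ε : ℝ) : ℝ := (Real.exp ε - 1) / (Real.exp ε + 1)

theorem signBias_nonneg {ε : ℝ} (hε : 0 ≤ ε) : 0 ≤ signBias ε :=
  div_nonneg (sub_nonneg.2 (Real.one_le_exp hε)) (by positivity)

theorem signBias_lt_one (ε : ℝ) : signBias ε < 1 :=
  (div_lt_one (by positivity)).2 (by linarith)

theorem abs_signBias_le_one {ε : ℝ} (hε : 0 ≤ ε) : |signBias ε| ≤ 1 :=
  (abs_of_nonneg (signBias_nonneg hε)).trans_le (signBias_lt_one ε).le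

/-- The probability of the label `(m, t)` when the mark `m` is `true` with probability `p`, and
the sign of the independent bit `t` has mean `d`. -/
noncomputable def cloneWeight (p d : ℝ) (l : Bool × Bool) : ℝ :=
  (if l.1 then p else 1 - p) * ((1 + d * boolSign l.2) / 2)

theorem cloneWeight_nonneg {p d : ℝ} (hp₀ : 0 ≤ p) (hp₁ : p ≤ 1) (hd : |d| ≤ 1)
    (l : Bool × Bool) : 0 ≤ cloneWeight p d l := by
  refine mul_nonneg ?_ (div_nonneg (one_add_mul_boolSign_nonneg hd l.2) zero_le_two)
  split_ifs <;> linarith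

section Decomposition

variable {D Z S : Type*} [MeasurableSpace Z] [MeasurableSpace S]

/-- The kernel with label `(m, t)`: a clone kernel `G t`, common to all records, if the mark `m`
is set, and a leftover kernel of the record `y` otherwise. -/
def cloneKernel (G : Bool → Kernel Z S) (L : D → Bool → Kernel Z S) (y : D) (l : Bool × Bool) :
    Kernel Z S :=
  if l.1 then G l.2 else L y l.2

instance cloneKernel.instIsMarkovKernel (G : Bool → Kernel Z S) (L : D → Bool → Kernel Z S)
    [∀ t, IsMarkovKernel (G t)] [∀ y t, IsMarkovKernel (L y t)] (y : D) (l : Bool × Bool) :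
    IsMarkovKernel (cloneKernel G L y l) := by
  unfold cloneKernel
  split_ifs <;> infer_instance

/-- The randomizers of `a` and `b` are opposite biased mixtures of the two clones, and every
randomizer is a clone with probability `exp (-ε)`, both clones being then equally likely. -/
def IsCloneDecomposition (ε : ℝ) (κ : D → Kernel Z S) (a b : D) (G : Bool → Kernel Z S)
    (L : D → Bool → Kernel Z S) : Prop :=
  (∀ y z, κ a z = ∑ l, ENNReal.ofReal (cloneWeight 1 (signBias ε) l) • cloneKernel G L y l z) ∧
  (∀ y z, κ b z = ∑ l, ENNReal.ofReal (cloneWeight 1 (-signBias ε) l) • cloneKernel G L y l z) ∧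
  ∀ y z, κ y z = ∑ l, ENNReal.ofReal (cloneWeight (Real.exp (-ε)) 0 l) • cloneKernel G L y l z

theorem eq_sum_cloneWeight_smul {G : Bool → Kernel Z S} {L : D → Bool → Kernel Z S}
    [∀ t, IsMarkovKernel (G t)] [∀ y t, IsMarkovKernel (L y t)] {p d : ℝ} (hp₀ : 0 ≤ p)
    (hp₁ : p ≤ 1) (hd : |d| ≤ 1) {μ : Measure S} [IsFiniteMeasure μ] (y : D) (z : Z)
    (h : ∀ s, MeasurableSet s → μ.real s =
      p * ((1 + d) / 2 * (G true z).real s + (1 - d) / 2 * (G false z).real s) +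
        (1 - p) * ((1 + d) / 2 * (L y true z).real s + (1 - d) / 2 * (L y false z).real s)) :
    μ = ∑ l, ENNReal.ofReal (cloneWeight p d l) • cloneKernel G L y l z := by
  refine eq_sum_ofReal_smul (cloneWeight_nonneg hp₀ hp₁ hd) fun s hs => ?_
  simp only [h s hs, Fintype.sum_prod_type, Fintype.sum_bool, cloneWeight, cloneKernel,
    boolSign, if_true, Bool.false_eq_true, if_false]
  ring

theorem exists_isCloneDecomposition {κ : D → Kernel Z S} [∀ x, IsMarkovKernel (κ x)] {ε : ℝ}
    (hε : 0 ≤ ε) (h : ∀ z, IsLDP ε fun x => κ x z) (a b : D) :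
    ∃ (G : Bool → Kernel Z S) (L : D → Bool → Kernel Z S),
      (∀ t, IsMarkovKernel (G t)) ∧ (∀ y t, IsMarkovKernel (L y t)) ∧
        IsCloneDecomposition ε κ a b G L := by
  have hle (x y : D) (z : Z) : κ x z ≤ ENNReal.ofReal (Real.exp ε) • κ y z :=
    Measure.le_iff.2 fun s hs => h z x y s hs
  have hbias := abs_signBias_le_one hε
  have hbias' : |-signBias ε| ≤ 1 := (abs_neg _).trans_le hbias
  have hexp : Real.exp (-ε) ≤ 1 := Real.exp_le_one_iff.2 (neg_nonpos.2 hε)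
  rcases hε.eq_or_lt with rfl | hpos
  · have heq (x z) : κ x z = κ a z :=
      Measure.eq_of_le_of_isProbabilityMeasure (by simpa using hle x a z)
    refine ⟨fun _ => κ a, fun _ _ => κ a, fun _ => inferInstance, fun _ _ => inferInstance,
      fun y z => eq_sum_cloneWeight_smul zero_le_one le_rfl hbias y z fun s _ => by ring,
      fun y z => eq_sum_cloneWeight_smul zero_le_one le_rfl hbias' y z fun s _ => ?_,
      fun y z => eq_sum_cloneWeight_smul (Real.exp_nonneg _) hexp (by simp) y z fun s _ => ?_⟩
    · rw [heq b]; ring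
    · rw [heq y]; ring
  · have hE : 1 < Real.exp ε := Real.one_lt_exp_iff.2 hpos
    choose ξ hξ hreal using fun x y => exists_residualKernel hE (κ x) (κ y) (hle y x)
    have hξreal (x y z s) (hs : MeasurableSet s) : (ξ x y z).real s =
        (Real.exp ε * (κ x z).real s - (κ y z).real s) / (Real.exp ε - 1) := by
      rw [← hreal x y z s hs, mul_div_cancel_left₀ _ (sub_pos.2 hE).ne']
    have hne : Real.exp ε - 1 ≠ 0 := (sub_pos.2 hE).ne'
    have hG (t : Bool) : IsMarkovKernel (if t then ξ a b else ξ b a) := by cases t <;> exact hξ _ _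
    have hL (y : D) (t : Bool) : IsMarkovKernel (if t then ξ y a else ξ y b) := by
      cases t <;> exact hξ _ _
    refine ⟨fun t => if t then ξ a b else ξ b a, fun y t => if t then ξ y a else ξ y b,
      hG, hL,
      fun y z => eq_sum_cloneWeight_smul zero_le_one le_rfl hbias y z fun s hs => ?_,
      fun y z => eq_sum_cloneWeight_smul zero_le_one le_rfl hbias' y z fun s hs => ?_,
      fun y z => eq_sum_cloneWeight_smul (Real.exp_nonneg _) hexp (by simp) y z fun s hs => ?_⟩
    all_goals
      simp only [if_true, Bool.false_eq_true, if_false, hξreal _ _ _ _ hs, signBias, Real.exp_neg]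
      field_simp
      ring

end Decomposition

theorem compProd_sum_smul {Z W ι Λ : Type*} [MeasurableSpace Z] [MeasurableSpace W] [Fintype ι]
    [Fintype Λ] (c : ι → ℝ≥0∞) (μ : ι → Measure Z) [∀ i, SFinite (μ i)] (w : Λ → ℝ≥0∞)
    (g : Λ → Kernel Z W) [∀ l, IsSFiniteKernel (g l)] (κ : Kernel Z W) [IsSFiniteKernel κ]
    (h : ∀ z, κ z = ∑ l, w l • g l z) :
    (∑ i, c i • μ i) ⊗ₘ κ = ∑ i, ∑ l, (c i * w l) • (μ i ⊗ₘ g l) := by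
  have : SFinite (∑ i, c i • μ i) := by
    rw [← Measure.sum_fintype]; infer_instance
  ext s hs
  have hmeas (l : Λ) : Measurable fun z => g l z (Prod.mk z ⁻¹' s) :=
    Kernel.measurable_kernel_prodMk_left hs
  simp only [Measure.compProd_apply hs, lintegral_finsetSum_measure, lintegral_smul_measure, h,
    Measure.coe_finsetSum, Finset.sum_apply, Measure.smul_apply, smul_eq_mul]
  refine Finset.sum_congr rfl fun i _ => ?_
  simp only [lintegral_finsetSum _ fun l _ => (hmeas l).const_mul (w l),
    lintegral_const_mul _ (hmeas _), Finset.mul_sum, mul_assoc]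

section Chain

/-- The kernels that turn the outputs of the steps before `i` into the law of the output of
step `i`. -/
abbrev StepKernel {n : ℕ} (S : Fin n → Type*) [∀ i, MeasurableSpace (S i)] (i : Fin n) :
    Type _ :=
  Kernel (∀ j : Fin i, S (j.castLE i.isLt.le)) (S i)

/-- The law of the chain `(z₁, …, zₙ)` in which `zᵢ` is drawn from `K i (z₁, …, zᵢ₋₁)`. -/
noncomputable def chainLaw : {n : ℕ} → {S : Fin n → Type*} → [∀ i, MeasurableSpace (S i)] →
    (∀ i, StepKernel S i) → Measure (∀ i, S i)
  | 0, _, _, _ => Measure.dirac fun i => i.elim0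
  | n + 1, S, _, K =>
    (chainLaw (S := fun i : Fin n => S i.castSucc) (fun i => K i.castSucc) ⊗ₘ K (Fin.last n)).map
      fun p => Fin.snoc (α := S) p.1 p.2

variable {n : ℕ} {S : Fin n → Type*} [∀ i, MeasurableSpace (S i)]

theorem AdaptiveProcess.partialLaw_eq_chainLaw {D : Type*} (R : AdaptiveProcess n D S)
    (X : Fin n → D) (k : ℕ) (hk : k ≤ n) :
    R.partialLaw X k hk = chainLaw (S := fun i : Fin k => S (i.castLE hk))
      fun i => R.randomizer (i.castLE hk) (X (i.castLE hk)) := by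
  induction k with
  | zero => rfl
  | succ k ih => rw [partialLaw, chainLaw, ih]; rfl

theorem AdaptiveProcess.law_eq_chainLaw {D : Type*} (R : AdaptiveProcess n D S) (X : Fin n → D) :
    R.law X = chainLaw fun i => R.randomizer i (X i) :=
  R.partialLaw_eq_chainLaw X n le_rfl

theorem measurable_snoc {n : ℕ} {S : Fin (n + 1) → Type*} [∀ i, MeasurableSpace (S i)] :
    Measurable fun p : (∀ i : Fin n, S i.castSucc) × S (Fin.last n) =>
      Fin.snoc (α := S) p.1 p.2 := by
  refine measurable_pi_lambda _ fun i => ?_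
  refine Fin.lastCases ?_ (fun i => ?_) i
  · simpa only [Fin.snoc_last] using measurable_snd
  · simpa only [Fin.snoc_castSucc, Function.comp_def] using
      (measurable_pi_apply i).comp measurable_fst

instance isProbabilityMeasure_chainLaw (K : ∀ i, StepKernel S i) [∀ i, IsMarkovKernel (K i)] :
    IsProbabilityMeasure (chainLaw K) := by
  induction n with
  | zero => rw [chainLaw]; infer_instance
  | succ n ih =>
    have := ih (S := fun i : Fin n => S i.castSucc) fun i => K i.castSucc
    rw [chainLaw]
    exact Measure.isProbabilityMeasure_map measurable_snoc.aemeasurable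

theorem chainLaw_eq_sum_smul {Λ : Type*} [Fintype Λ] (K : ∀ i, StepKernel S i)
    [∀ i, IsMarkovKernel (K i)] (G : ∀ i, Λ → StepKernel S i) [∀ i l, IsMarkovKernel (G i l)]
    (w : Fin n → Λ → ℝ≥0∞) (h : ∀ i z, K i z = ∑ l, w i l • G i l z) :
    chainLaw K = ∑ τ : Fin n → Λ, (∏ i, w i (τ i)) • chainLaw fun i => G i (τ i) := by
  induction n with
  | zero => simp [chainLaw]
  | succ n ih =>
    rw [chainLaw, ih (S := fun i : Fin n => S i.castSucc) (fun i => K i.castSucc)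
      (fun i => G i.castSucc) (fun i => w i.castSucc) fun i => h i.castSucc]
    have (τ : Fin n → Λ) : IsProbabilityMeasure
        (chainLaw (S := fun i : Fin n => S i.castSucc) fun i => G i.castSucc (τ i)) :=
      isProbabilityMeasure_chainLaw (S := fun i : Fin n => S i.castSucc) _
    rw [compProd_sum_smul _ _ (w (Fin.last n)) (G (Fin.last n)) _ (h (Fin.last n)),
      ← Fintype.sum_prod_type', Measure.map_finset_sum measurable_snoc.aemeasurable]
    refine Fintype.sum_equiv ((Equiv.prodComm _ _).trans (Fin.snocEquiv fun _ => Λ)) _ _ ?_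
    rintro ⟨τ, l⟩
    simp only [Measure.map_smul, chainLaw, Fin.prod_univ_castSucc, Equiv.trans_apply,
      Equiv.prodComm_apply, Prod.swap_prod_mk, Fin.snocEquiv_apply, Fin.snoc_castSucc,
      Fin.snoc_last]

end Chain

open scoped BigOperators Nat

section Shuffle

variable {n : ℕ} {D : Type*} {S : Fin n → Type*} [∀ i, MeasurableSpace (S i)]

/-- The law of the chain whose step `i` serves the record `π i` by the kernel which that record
uses when its label is `τ (π i)`. -/
noncomputable def labelledLaw {Λ : Type*} (K : ∀ i, Fin n → Λ → StepKernel S i)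
    (π : Equiv.Perm (Fin n)) (τ : Fin n → Λ) : Measure (∀ i, S i) :=
  chainLaw fun i => K i (π i) (τ (π i))

instance isProbabilityMeasure_labelledLaw {Λ : Type*} (K : ∀ i, Fin n → Λ → StepKernel S i)
    [∀ i j l, IsMarkovKernel (K i j l)] (π : Equiv.Perm (Fin n)) (τ : Fin n → Λ) :
    IsProbabilityMeasure (labelledLaw K π τ) :=
  isProbabilityMeasure_chainLaw _

theorem AdaptiveProcess.shuffledLaw_eq_sum_labelledLaw {Λ : Type*} [Fintype Λ]
    (R : AdaptiveProcess n D S) (X : Fin n → D) (K : ∀ i, Fin n → Λ → StepKernel S i)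
    [∀ i j l, IsMarkovKernel (K i j l)] (w : Fin n → Λ → ℝ≥0∞)
    (hR : ∀ i j z, R.randomizer i (X j) z = ∑ l, w j l • K i j l z) :
    R.shuffledLaw X = (n ! : ℝ≥0∞)⁻¹ • ∑ π : Equiv.Perm (Fin n), ∑ τ : Fin n → Λ,
      (∏ j, w j (τ j)) • labelledLaw K π τ := by
  have := R.isMarkov
  rw [shuffledLaw, Fintype.card_perm, Fintype.card_fin]
  congr 1
  refine Finset.sum_congr rfl fun π _ => ?_
  rw [law_eq_chainLaw, chainLaw_eq_sum_smul _ (fun i => K i (π i)) _ fun i z => hR i (π i) z]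
  refine Fintype.sum_equiv (π.arrowCongr (Equiv.refl Λ)) _ _ fun τ => ?_
  rw [← Equiv.prod_comp π fun j => w j _]
  simp only [labelledLaw, Equiv.arrowCongr_apply, Equiv.coe_refl, Function.comp_apply, id,
    Equiv.symm_apply_apply]

theorem labelledLaw_swap {Λ : Type*} (K : ∀ i, Fin n → Λ → StepKernel S i)
    (π : Equiv.Perm (Fin n)) (τ : Fin n → Λ) {a j : Fin n} (ha : ∀ i, K i j (τ a) = K i a (τ a))
    (hj : ∀ i, K i a (τ j) = K i j (τ j)) :
    labelledLaw K (Equiv.swap a j * π) (τ ∘ Equiv.swap a j) = labelledLaw K π τ := by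
  rw [labelledLaw, labelledLaw]
  congr 1
  funext i
  rw [Equiv.Perm.mul_apply, Function.comp_apply, Equiv.swap_apply_self]
  rcases eq_or_ne (π i) a with h | ha'
  · rw [h, Equiv.swap_apply_left, ha]
  rcases eq_or_ne (π i) j with h | hj'
  · rw [h, Equiv.swap_apply_right, hj]
  · rw [Equiv.swap_apply_of_ne_of_ne ha' hj']

theorem sum_ofReal_expect_smul {Ω ι κ : Type*} [MeasurableSpace Ω] [Fintype κ] {T : Finset ι}
    (hT : T.Nonempty) {w : ι → κ → ℝ} (hw : ∀ j k, 0 ≤ w j k) {M : κ → Measure Ω} {μ : Measure Ω}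
    (h : ∀ j ∈ T, ∑ k, ENNReal.ofReal (w j k) • M k = μ) :
    ∑ k, ENNReal.ofReal (𝔼 j ∈ T, w j k) • M k = μ := by
  have hcard : (T.card : ℝ≥0∞) ≠ 0 := by simpa using hT.ne_empty
  have hw' (k : κ) : ENNReal.ofReal (𝔼 j ∈ T, w j k) =
      (T.card : ℝ≥0∞)⁻¹ * ∑ j ∈ T, ENNReal.ofReal (w j k) := by
    rw [Finset.expect_eq_sum_div_card, ENNReal.ofReal_div_of_pos (by simpa using hT),
      ENNReal.ofReal_sum_of_nonneg fun j _ => hw j k, ENNReal.ofReal_natCast,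
      ENNReal.div_eq_inv_mul]
  simp only [hw', mul_smul, Finset.sum_smul, ← Finset.smul_sum]
  rw [Finset.sum_comm, Finset.sum_congr rfl h, Finset.sum_const, ← Nat.cast_smul_eq_nsmul ℝ≥0∞,
    smul_smul, ENNReal.inv_mul_cancel hcard (by finiteness), one_smul]

/-- The labels `(mark, sign)` of the records when `T` is the set of marked records. -/
def markedLabels {ι : Type*} [DecidableEq ι] (T : Finset ι) (s : ι → Bool) (j : ι) : Bool × Bool :=
  (decide (j ∈ T), s j)

theorem bijective_markedLabels {ι : Type*} [DecidableEq ι] [Finite ι] :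
    Function.Bijective fun p : Finset ι × (ι → Bool) => markedLabels p.1 p.2 := by
  cases nonempty_fintype ι
  refine Function.bijective_iff_has_inverse.2
    ⟨fun τ => (Finset.univ.filter fun j => (τ j).1, fun j => (τ j).2), fun p => ?_, fun τ => ?_⟩
  · simp [markedLabels]
  · funext j
    simp [markedLabels]

/-- The mean sign of the records in `T`, with the value `0` if `T` is empty. -/
noncomputable def meanSign {ι : Type*} (T : Finset ι) (s : ι → Bool) : ℝ :=
  𝔼 j ∈ T, boolSign (s j)

variable (G : ∀ i, Bool → StepKernel S i) (L : ∀ i, D → Bool → StepKernel S i) (X : Fin n → D)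

/-- The law of the chain in which the records of `T` are served by the clones `G`, selected by
their signs `s`, and the other records of `X` by their leftover kernels `L`. -/
noncomputable def cloneLaw (T : Finset (Fin n)) (π : Equiv.Perm (Fin n)) (s : Fin n → Bool) :
    Measure (∀ i, S i) :=
  labelledLaw (fun i j => cloneKernel (G i) (L i) (X j)) π (markedLabels T s)

instance isProbabilityMeasure_cloneLaw [∀ i t, IsMarkovKernel (G i t)]
    [∀ i y t, IsMarkovKernel (L i y t)] (T : Finset (Fin n)) (π : Equiv.Perm (Fin n))
    (s : Fin n → Bool) : IsProbabilityMeasure (cloneLaw G L X T π s) :=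
  isProbabilityMeasure_labelledLaw _ _ _

theorem cloneLaw_swap {T : Finset (Fin n)} {a j : Fin n} (ha : a ∈ T) (hj : j ∈ T)
    (π : Equiv.Perm (Fin n)) (s : Fin n → Bool) :
    cloneLaw G L X T (Equiv.swap a j * π) (s ∘ Equiv.swap a j) = cloneLaw G L X T π s := by
  have hlabels : markedLabels T (s ∘ Equiv.swap a j) = markedLabels T s ∘ Equiv.swap a j := by
    funext i
    have : Equiv.swap a j i ∈ T ↔ i ∈ T := by
      rcases eq_or_ne i a with rfl | hia
      · simp [ha, hj]
      rcases eq_or_ne i j with rfl | hij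
      · simp [ha, hj]
      · rw [Equiv.swap_apply_of_ne_of_ne hia hij]
    simp only [markedLabels, Function.comp_apply, this]
  rw [cloneLaw, hlabels]
  exact labelledLaw_swap _ π _ (fun i => by simp [cloneKernel, markedLabels, ha])
    (fun i => by simp [cloneKernel, markedLabels, hj])

theorem sum_smul_cloneLaw_eq_sum_expect {T : Finset (Fin n)} {a : Fin n} (ha : a ∈ T)
    {h : Bool → ℝ} (hh : ∀ t, 0 ≤ h t) :
    ∑ p : Equiv.Perm (Fin n) × (Fin n → Bool),
        ENNReal.ofReal (h (p.2 a)) • cloneLaw G L X T p.1 p.2 =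
      ∑ p : Equiv.Perm (Fin n) × (Fin n → Bool),
        ENNReal.ofReal (𝔼 j ∈ T, h (p.2 j)) • cloneLaw G L X T p.1 p.2 := by
  refine (sum_ofReal_expect_smul ⟨a, ha⟩ (fun j _ => hh _) fun j hj => ?_).symm
  refine Fintype.sum_equiv ((Equiv.mulLeft (Equiv.swap a j)).prodCongr
    ((Equiv.swap a j).arrowCongr (Equiv.refl Bool))) _ _ fun p => ?_
  have hs : (Equiv.swap a j).arrowCongr (Equiv.refl Bool) p.2 = p.2 ∘ Equiv.swap a j := rfl
  simp only [Equiv.prodCongr_apply, Prod.map_fst, Prod.map_snd, hs, Equiv.coe_mulLeft,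
    cloneLaw_swap G L X ha hj, Function.comp_apply, Equiv.swap_apply_left]

theorem sum_smul_cloneLaw_eq_sum_meanSign {T : Finset (Fin n)} {a : Fin n} (ha : a ∈ T) {d : ℝ}
    (hd : |d| ≤ 1) :
    ∑ q : Equiv.Perm (Fin n) × (Fin n → Bool),
        ENNReal.ofReal (1 + d * boolSign (q.2 a)) • cloneLaw G L X T q.1 q.2 =
      ∑ q : Equiv.Perm (Fin n) × (Fin n → Bool),
        ENNReal.ofReal (1 + d * meanSign T q.2) • cloneLaw G L X T q.1 q.2 := by
  rw [sum_smul_cloneLaw_eq_sum_expect G L X ha (one_add_mul_boolSign_nonneg hd)]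
  simp only [Finset.expect_add_distrib, Finset.expect_const ⟨a, ha⟩, ← Finset.mul_expect,
    meanSign]

/-- The probability that `T` is the set of marked records when record `j` is marked, independently
of the others, with probability `p j`. -/
def markWeight {ι : Type*} [Fintype ι] [DecidableEq ι] (p : ι → ℝ) (T : Finset ι) : ℝ :=
  ∏ j, if j ∈ T then p j else 1 - p j

theorem markWeight_nonneg {ι : Type*} [Fintype ι] [DecidableEq ι] {p : ι → ℝ}
    (hp₀ : ∀ j, 0 ≤ p j) (hp₁ : ∀ j, p j ≤ 1) (T : Finset ι) : 0 ≤ markWeight p T :=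
  Finset.prod_nonneg fun j _ => by
    split_ifs
    exacts [hp₀ j, sub_nonneg.2 (hp₁ j)]

theorem markWeight_eq_zero {ι : Type*} [Fintype ι] [DecidableEq ι] {p : ι → ℝ} {a : ι}
    (ha : p a = 1) {T : Finset ι} (haT : a ∉ T) : markWeight p T = 0 :=
  Finset.prod_eq_zero (Finset.mem_univ a) (by rw [if_neg haT, ha, sub_self])

theorem prod_cloneWeight_markedLabels {ι : Type*} [Fintype ι] [DecidableEq ι] (p : ι → ℝ) (a : ι)
    (d : ℝ) (T : Finset ι) (s : ι → Bool) :
    ∏ j, cloneWeight (p j) ((Pi.single a d : ι → ℝ) j) (markedLabels T s j) =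
      markWeight p T * ((2 ^ Fintype.card ι)⁻¹ * (1 + d * boolSign (s a))) := by
  have hsign : ∏ j, (1 + (Pi.single a d : ι → ℝ) j * boolSign (s j)) = 1 + d * boolSign (s a) := by
    rw [Finset.prod_eq_single a (fun j _ hj => by rw [Pi.single_eq_of_ne hj, zero_mul, add_zero])
      (by simp), Pi.single_eq_same]
  simp only [cloneWeight, markedLabels, decide_eq_true_eq, Finset.prod_mul_distrib,
    Finset.prod_div_distrib, hsign, Finset.prod_const, Finset.card_univ, markWeight]
  ring

theorem AdaptiveProcess.shuffledLaw_eq_sum_cloneLaw [∀ i t, IsMarkovKernel (G i t)]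
    [∀ i y t, IsMarkovKernel (L i y t)] (R : AdaptiveProcess n D S) (Y : Fin n → D) {p : Fin n → ℝ}
    (hp₀ : ∀ j, 0 ≤ p j) (hp₁ : ∀ j, p j ≤ 1) (a : Fin n) {d : ℝ} (hd : |d| ≤ 1)
    (hR : ∀ i j z, R.randomizer i (Y j) z =
      ∑ l, ENNReal.ofReal (cloneWeight (p j) ((Pi.single a d : Fin n → ℝ) j) l) •
        cloneKernel (G i) (L i) (X j) l z) :
    R.shuffledLaw Y = (n ! : ℝ≥0∞)⁻¹ • ∑ T : Finset (Fin n),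
      ENNReal.ofReal (markWeight p T * (2 ^ n)⁻¹) •
        ∑ q : Equiv.Perm (Fin n) × (Fin n → Bool),
          ENNReal.ofReal (1 + d * boolSign (q.2 a)) • cloneLaw G L X T q.1 q.2 := by
  have hbias (j : Fin n) : |(Pi.single a d : Fin n → ℝ) j| ≤ 1 := by
    rcases eq_or_ne j a with rfl | hj
    · rwa [Pi.single_eq_same]
    · simp [Pi.single_eq_of_ne hj]
  have hweight (T : Finset (Fin n)) (s : Fin n → Bool) :
      ∏ j, ENNReal.ofReal (cloneWeight (p j) ((Pi.single a d : Fin n → ℝ) j)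
          (markedLabels T s j)) =
        ENNReal.ofReal (markWeight p T * (2 ^ n)⁻¹) *
          ENNReal.ofReal (1 + d * boolSign (s a)) := by
    rw [← ENNReal.ofReal_prod_of_nonneg fun j _ => cloneWeight_nonneg (hp₀ j) (hp₁ j) (hbias j) _,
      prod_cloneWeight_markedLabels, Fintype.card_fin, ← mul_assoc,
      ENNReal.ofReal_mul' (one_add_mul_boolSign_nonneg hd _)]
  rw [R.shuffledLaw_eq_sum_labelledLaw Y _ _ hR]
  congr 1
  simp only [← bijective_markedLabels.sum_comp, Fintype.sum_prod_type, hweight, mul_smul,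
    Finset.smul_sum]
  exact Finset.sum_comm

/-- The probability of the triple (marked records, permutation, signs) when the marks follow
`markWeight p`, and the permutation and the signs are uniform. -/
noncomputable def configWeight (p : Fin n → ℝ)
    (k : Finset (Fin n) × Equiv.Perm (Fin n) × (Fin n → Bool)) : ℝ :=
  (n ! : ℝ)⁻¹ * (markWeight p k.1 * (2 ^ n)⁻¹)

theorem configWeight_nonneg {p : Fin n → ℝ} (hp₀ : ∀ j, 0 ≤ p j) (hp₁ : ∀ j, p j ≤ 1)
    (k : Finset (Fin n) × Equiv.Perm (Fin n) × (Fin n → Bool)) : 0 ≤ configWeight p k :=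
  mul_nonneg (by positivity) (mul_nonneg (markWeight_nonneg hp₀ hp₁ k.1) (by positivity))

theorem sum_configWeight_mul (p : Fin n → ℝ) (F : Finset (Fin n) → (Fin n → Bool) → ℝ) :
    ∑ k, configWeight p k * F k.1 k.2.2 = ∑ T, markWeight p T * 𝔼 s, F T s := by
  have hfactorial : (n ! : ℝ) ≠ 0 := by positivity
  simp only [Fintype.sum_prod_type, configWeight, Fintype.expect_eq_sum_div_card,
    Finset.sum_const, Finset.card_univ, Fintype.card_perm, Fintype.card_fun, Fintype.card_bool,
    Fintype.card_fin, nsmul_eq_mul, Nat.cast_pow, Nat.cast_ofNat, ← Finset.mul_sum]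
  refine Finset.sum_congr rfl fun T _ => ?_
  field_simp

theorem AdaptiveProcess.shuffledLaw_eq_tiltedMixture [∀ i t, IsMarkovKernel (G i t)]
    [∀ i y t, IsMarkovKernel (L i y t)] (R : AdaptiveProcess n D S) (Y : Fin n → D) {p : Fin n → ℝ}
    (hp₀ : ∀ j, 0 ≤ p j) (hp₁ : ∀ j, p j ≤ 1) {a : Fin n} (ha : p a = 1) {d : ℝ} (hd : |d| ≤ 1)
    (hR : ∀ i j z, R.randomizer i (Y j) z =
      ∑ l, ENNReal.ofReal (cloneWeight (p j) ((Pi.single a d : Fin n → ℝ) j) l) •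
        cloneKernel (G i) (L i) (X j) l z) :
    R.shuffledLaw Y =
      tiltedMixture (configWeight p) (fun k => d * meanSign k.1 k.2.2)
        fun k => cloneLaw G L X k.1 k.2.1 k.2.2 := by
  have hfactorial : ENNReal.ofReal (n ! : ℝ)⁻¹ = (n ! : ℝ≥0∞)⁻¹ := by
    rw [ENNReal.ofReal_inv_of_pos (by positivity), ENNReal.ofReal_natCast]
  rw [R.shuffledLaw_eq_sum_cloneLaw G L X Y hp₀ hp₁ a hd hR, tiltedMixture,
    Fintype.sum_prod_type, Finset.smul_sum]
  refine Finset.sum_congr rfl fun T _ => ?_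
  by_cases haT : a ∈ T
  · rw [sum_smul_cloneLaw_eq_sum_meanSign G L X haT hd, Finset.smul_sum, Finset.smul_sum]
    refine Finset.sum_congr rfl fun q _ => ?_
    have hw := mul_nonneg (markWeight_nonneg hp₀ hp₁ T) (by positivity : 0 ≤ ((2 : ℝ) ^ n)⁻¹)
    rw [smul_smul, smul_smul, configWeight, mul_assoc (n ! : ℝ)⁻¹,
      ENNReal.ofReal_mul (p := (n ! : ℝ)⁻¹) (by positivity), ENNReal.ofReal_mul hw, hfactorial,
      mul_assoc]
  · simp [configWeight, markWeight_eq_zero ha haT]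

end Shuffle

section SignMoments

theorem boolSign_not (t : Bool) : boolSign (!t) = -boolSign t := by
  cases t <;> simp [boolSign]

theorem abs_boolSign (t : Bool) : |boolSign t| = 1 := by
  cases t <;> simp [boolSign]

variable {ι : Type*}

theorem abs_meanSign_le_one (T : Finset ι) (s : ι → Bool) : |meanSign T s| ≤ 1 := by
  rcases T.eq_empty_or_nonempty with rfl | hT
  · simp [meanSign]
  · refine (Finset.abs_expect_le T _).trans_eq ?_
    simp only [abs_boolSign, Finset.expect_const hT]

variable [Fintype ι] [DecidableEq ι]

theorem expect_sum_boolSign_insert (F : ℝ → ℝ) {a : ι} {A : Finset ι} (ha : a ∉ A) :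
    𝔼 s : ι → Bool, F (∑ j ∈ insert a A, boolSign (s j)) =
      𝔼 s : ι → Bool, (F (∑ j ∈ A, boolSign (s j) + 1) + F (∑ j ∈ A, boolSign (s j) - 1)) / 2 := by
  have hinv : Function.Involutive fun s : ι → Bool => Function.update s a (!s a) := fun s => by
    simp
  have hflip : 𝔼 s : ι → Bool, F (∑ j ∈ insert a A, boolSign (s j)) =
      𝔼 s : ι → Bool, F (∑ j ∈ A, boolSign (s j) - boolSign (s a)) := by
    refine Fintype.expect_equiv hinv.toPerm _ _ fun s => ?_
    have hA : ∀ j ∈ A, boolSign (Function.update s a (!s a) j) = boolSign (s j) := fun j hj => by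
      rw [Function.update_of_ne (ne_of_mem_of_not_mem hj ha)]
    simp only [Function.Involutive.coe_toPerm, Finset.sum_congr rfl hA, Function.update_self,
      boolSign_not, sub_neg_eq_add, Finset.sum_insert ha, add_comm]
  have hpair (s : ι → Bool) : F (∑ j ∈ insert a A, boolSign (s j)) +
      F (∑ j ∈ A, boolSign (s j) - boolSign (s a)) =
        F (∑ j ∈ A, boolSign (s j) + 1) + F (∑ j ∈ A, boolSign (s j) - 1) := by
    rw [Finset.sum_insert ha, add_comm (boolSign _)]
    cases s a
    · rw [show boolSign false = -1 from if_neg Bool.false_ne_true, sub_neg_eq_add,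
        ← sub_eq_add_neg, add_comm]
    · rw [show boolSign true = 1 from if_pos rfl]
  rw [← Finset.expect_div, ← Finset.expect_congr rfl fun s _ => hpair s,
    Finset.expect_add_distrib, ← hflip, add_self_div_two]

theorem expect_sum_boolSign (A : Finset ι) : 𝔼 s : ι → Bool, ∑ j ∈ A, boolSign (s j) = 0 := by
  induction A using Finset.induction_on with
  | empty => simp
  | insert a A ha ih =>
    rw [expect_sum_boolSign_insert (fun x => x) ha, ← ih]
    exact Finset.expect_congr rfl fun s _ => by ring

theorem expect_sum_boolSign_sq (A : Finset ι) :
    𝔼 s : ι → Bool, (∑ j ∈ A, boolSign (s j)) ^ 2 = A.card := by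
  induction A using Finset.induction_on with
  | empty => simp
  | insert a A ha ih =>
    have hsq (x : ℝ) : ((x + 1) ^ 2 + (x - 1) ^ 2) / 2 = x ^ 2 + 1 := by ring
    simp only [expect_sum_boolSign_insert (fun x => x ^ 2) ha, hsq, Finset.expect_add_distrib, ih,
      Fintype.expect_const, Finset.card_insert_of_notMem ha, Nat.cast_add, Nat.cast_one]

theorem expect_sum_boolSign_pow_four_le (A : Finset ι) :
    𝔼 s : ι → Bool, (∑ j ∈ A, boolSign (s j)) ^ 4 ≤ 3 * (A.card : ℝ) ^ 2 := by
  induction A using Finset.induction_on with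
  | empty => simp
  | insert a A ha ih =>
    have hpow (x : ℝ) : ((x + 1) ^ 4 + (x - 1) ^ 4) / 2 = x ^ 4 + 6 * x ^ 2 + 1 := by ring
    simp only [expect_sum_boolSign_insert (fun x => x ^ 4) ha, hpow, Finset.expect_add_distrib,
      ← Finset.mul_expect, expect_sum_boolSign_sq, Fintype.expect_const,
      Finset.card_insert_of_notMem ha, Nat.cast_add, Nat.cast_one]
    linarith

theorem expect_meanSign (T : Finset ι) : 𝔼 s : ι → Bool, meanSign T s = 0 := by
  simp only [meanSign, Finset.expect_eq_sum_div_card T, ← Finset.expect_div, expect_sum_boolSign,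
    zero_div]

theorem expect_meanSign_sq (T : Finset ι) :
    𝔼 s : ι → Bool, meanSign T s ^ 2 = (T.card : ℝ)⁻¹ := by
  simp only [meanSign, Finset.expect_eq_sum_div_card T, div_pow, ← Finset.expect_div,
    expect_sum_boolSign_sq]
  rw [sq, div_self_mul_self']

theorem expect_meanSign_pow_four_le (T : Finset ι) :
    𝔼 s : ι → Bool, meanSign T s ^ 4 ≤ 3 * ((T.card : ℝ) ^ 2)⁻¹ := by
  simp only [meanSign, Finset.expect_eq_sum_div_card T, div_pow, ← Finset.expect_div]
  calc (𝔼 s : ι → Bool, (∑ j ∈ T, boolSign (s j)) ^ 4) / (T.card : ℝ) ^ 4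
      ≤ 3 * (T.card : ℝ) ^ 2 / (T.card : ℝ) ^ 4 := by
        gcongr
        exact expect_sum_boolSign_pow_four_le T
    _ = 3 * ((T.card : ℝ) ^ 2)⁻¹ := by
        rcases eq_or_ne (T.card : ℝ) 0 with h | h
        · simp [h]
        · field_simp

theorem expect_comp_mul_meanSign_le {f : ℝ → ℝ} {A B K c : ℝ} (hK : 0 ≤ K)
    (hf : ∀ u, |u| ≤ |c| → f u ≤ 1 + A * u + B * u ^ 2 + K * u ^ 4) (T : Finset ι) :
    𝔼 s : ι → Bool, f (c * meanSign T s) ≤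
      1 + B * c ^ 2 * (T.card : ℝ)⁻¹ + 3 * K * c ^ 4 * ((T.card : ℝ) ^ 2)⁻¹ := by
  have hbound (s : ι → Bool) : |c * meanSign T s| ≤ |c| := by
    rw [abs_mul]
    exact mul_le_of_le_one_right (abs_nonneg c) (abs_meanSign_le_one T s)
  calc 𝔼 s : ι → Bool, f (c * meanSign T s)
      ≤ 𝔼 s : ι → Bool, (1 + A * c * meanSign T s + B * c ^ 2 * meanSign T s ^ 2 +
          K * c ^ 4 * meanSign T s ^ 4) :=
        Finset.expect_le_expect fun s _ => (hf _ (hbound s)).trans_eq (by ring)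
    _ = 1 + B * c ^ 2 * (T.card : ℝ)⁻¹ + K * c ^ 4 * 𝔼 s : ι → Bool, meanSign T s ^ 4 := by
        simp only [Finset.expect_add_distrib, ← Finset.mul_expect, expect_meanSign,
          expect_meanSign_sq, Fintype.expect_const]
        ring
    _ ≤ 1 + B * c ^ 2 * (T.card : ℝ)⁻¹ + K * c ^ 4 * (3 * ((T.card : ℝ) ^ 2)⁻¹) := by
        gcongr
        exact expect_meanSign_pow_four_le T
    _ = 1 + B * c ^ 2 * (T.card : ℝ)⁻¹ + 3 * K * c ^ 4 * ((T.card : ℝ) ^ 2)⁻¹ := by ring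

end SignMoments

section BinomialMoments

/-- The expectation of `f k` for a binomial variable `k` with `N` trials and success
probability `r`. -/
def binomialMean (r : ℝ) (N : ℕ) (f : ℕ → ℝ) : ℝ :=
  ∑ k ∈ Finset.range (N + 1), N.choose k * (r ^ k * (1 - r) ^ (N - k)) * f k

theorem binomialMean_one (r : ℝ) (N : ℕ) : binomialMean r N (fun _ => 1) = 1 := by
  have h := add_pow r (1 - r) N
  rw [add_sub_cancel, one_pow] at h
  refine (Finset.sum_congr rfl fun k _ => ?_).trans h.symm
  ring

theorem binomialMean_mono {r : ℝ} (hr₀ : 0 ≤ r) (hr₁ : r ≤ 1) (N : ℕ) {f g : ℕ → ℝ}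
    (hfg : ∀ k, f k ≤ g k) : binomialMean r N f ≤ binomialMean r N g := by
  have := sub_nonneg.2 hr₁
  exact Finset.sum_le_sum fun k _ => mul_le_mul_of_nonneg_left (hfg k) (by positivity)

theorem binomialMean_add (r : ℝ) (N : ℕ) (f g : ℕ → ℝ) :
    binomialMean r N (fun k => f k + g k) = binomialMean r N f + binomialMean r N g := by
  simp only [binomialMean, mul_add, Finset.sum_add_distrib]

theorem binomialMean_const_mul (r : ℝ) (N : ℕ) (b : ℝ) (f : ℕ → ℝ) :
    binomialMean r N (fun k => b * f k) = b * binomialMean r N f := by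
  simp only [binomialMean, mul_left_comm _ b, Finset.mul_sum]

-- Size biasing: a binomial variable on `N + 1` trials, weighted by its value, is `1` plus a
-- binomial variable on `N` trials.
theorem mul_binomialMean_div_succ (r : ℝ) (N : ℕ) (f : ℕ → ℝ) :
    (N + 1) * r * binomialMean r N (fun k => f (k + 1) / (k + 1)) =
      binomialMean r (N + 1) f - (1 - r) ^ (N + 1) * f 0 := by
  have hterm (k : ℕ) : (N + 1) * r *
      (N.choose k * (r ^ k * (1 - r) ^ (N - k)) * (f (k + 1) / (k + 1))) =
        (N + 1).choose (k + 1) * (r ^ (k + 1) * (1 - r) ^ (N - k)) * f (k + 1) := by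
    have hchoose : ((N : ℝ) + 1) * N.choose k = (N + 1).choose (k + 1) * (k + 1) := by
      exact_mod_cast Nat.add_one_mul_choose_eq N k
    field_simp
    linear_combination f (k + 1) * (1 - r) ^ (N - k) * r ^ k * r * hchoose
  simp only [binomialMean, Finset.sum_range_succ' _ (N + 1), Finset.mul_sum, hterm,
    Nat.add_sub_add_right, Nat.choose_zero_right, Nat.cast_one, pow_zero, one_mul, Nat.sub_zero,
    add_sub_cancel_right]

theorem binomialMean_div_succ_le {r : ℝ} (hr₀ : 0 < r) (hr₁ : r ≤ 1) (N : ℕ) {f : ℕ → ℝ}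
    (hf : 0 ≤ f 0) :
    binomialMean r N (fun k => f (k + 1) / (k + 1)) ≤
      ((N + 1) * r)⁻¹ * binomialMean r (N + 1) f := by
  rw [← div_eq_inv_mul, le_div_iff₀' (by positivity), mul_binomialMean_div_succ]
  exact sub_le_self _ (mul_nonneg (pow_nonneg (sub_nonneg.2 hr₁) _) hf)

theorem binomialMean_inv_succ_le {r : ℝ} (hr₀ : 0 < r) (hr₁ : r ≤ 1) (N : ℕ) :
    binomialMean r N (fun k => ((k : ℝ) + 1)⁻¹) ≤ ((N + 1) * r)⁻¹ := by
  simpa only [one_div, binomialMean_one, mul_one] using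
    binomialMean_div_succ_le hr₀ hr₁ N (f := fun _ => 1) zero_le_one

theorem binomialMean_inv_succ_sq_le {r : ℝ} (hr₀ : 0 < r) (hr₁ : r ≤ 1) (N : ℕ) :
    binomialMean r N (fun k => (((k : ℝ) + 1) ^ 2)⁻¹) ≤ 2 * ((N + 1) * r)⁻¹ ^ 2 := by
  have hsucc (k : ℕ) :
      (((k : ℝ) + 1) ^ 2)⁻¹ ≤ 2 * ((((k + 1 : ℕ) : ℝ) + 1)⁻¹ / ((k : ℝ) + 1)) := by
    push_cast
    rw [inv_div_left, ← div_eq_mul_inv, le_div_iff₀ (by positivity),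
      inv_mul_le_iff₀ (by positivity)]
    nlinarith [(k.cast_nonneg : (0 : ℝ) ≤ k)]
  calc binomialMean r N (fun k => (((k : ℝ) + 1) ^ 2)⁻¹)
      ≤ 2 * binomialMean r N (fun k => (((k + 1 : ℕ) : ℝ) + 1)⁻¹ / ((k : ℝ) + 1)) := by
        rw [← binomialMean_const_mul]
        exact binomialMean_mono hr₀.le hr₁ N hsucc
    _ ≤ 2 * (((N + 1) * r)⁻¹ * (((N + 1 : ℕ) + 1) * r)⁻¹) := by
        gcongr
        refine (binomialMean_div_succ_le hr₀ hr₁ N (f := fun k => ((k : ℝ) + 1)⁻¹)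
          (by simp)).trans ?_
        gcongr
        exact binomialMean_inv_succ_le hr₀ hr₁ (N + 1)
    _ ≤ 2 * ((N + 1) * r)⁻¹ ^ 2 := by
        rw [sq]
        gcongr
        linarith

variable {ι : Type*} [Fintype ι] [DecidableEq ι]

theorem markWeight_update_insert (r : ℝ) {a : ι} {A : Finset ι} (ha : a ∉ A) :
    markWeight (Function.update (fun _ => r) a 1) (insert a A) =
      r ^ A.card * (1 - r) ^ (Fintype.card ι - 1 - A.card) := by
  have hsub : A ⊆ Finset.univ.erase a :=
    fun j hj => Finset.mem_erase.2 ⟨ne_of_mem_of_not_mem hj ha, Finset.mem_univ j⟩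
  have hfactor : ∀ j ∈ Finset.univ.erase a,
      (if j ∈ insert a A then Function.update (fun _ => r) a 1 j
        else 1 - Function.update (fun _ => r) a 1 j) = if j ∈ A then r else 1 - r := fun j hj => by
    have hja := Finset.ne_of_mem_erase hj
    simp only [Finset.mem_insert, hja, false_or, Function.update_of_ne hja]
  rw [markWeight, ← Finset.mul_prod_erase _ _ (Finset.mem_univ a), Finset.prod_congr rfl hfactor,
    if_pos (Finset.mem_insert_self a A), Function.update_self, one_mul, Finset.prod_ite,
    Finset.prod_const, Finset.prod_const, Finset.filter_mem_eq_inter,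
    Finset.inter_eq_right.2 hsub, Finset.filter_notMem_eq_sdiff, Finset.card_sdiff_of_subset hsub,
    Finset.card_erase_of_mem (Finset.mem_univ a), Finset.card_univ]

theorem sum_markWeight_update_mul (r : ℝ) (a : ι) (f : ℕ → ℝ) :
    ∑ T : Finset ι, markWeight (Function.update (fun _ => r) a 1) T * f T.card =
      binomialMean r (Fintype.card ι - 1) fun k => f (k + 1) := by
  have ha := Finset.notMem_erase a Finset.univ
  have hcard : (Finset.univ.erase a).card = Fintype.card ι - 1 := by
    rw [Finset.card_erase_of_mem (Finset.mem_univ a), Finset.card_univ]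
  rw [← Finset.powerset_univ, ← Finset.insert_erase (Finset.mem_univ a),
    Finset.sum_powerset_insert ha, Finset.sum_eq_zero, zero_add]
  · calc ∑ A ∈ (Finset.univ.erase a).powerset,
          markWeight (Function.update (fun _ => r) a 1) (insert a A) * f (insert a A).card
        = ∑ A ∈ (Finset.univ.erase a).powerset,
            r ^ A.card * (1 - r) ^ (Fintype.card ι - 1 - A.card) * f (A.card + 1) :=
          Finset.sum_congr rfl fun A hA => by
            have haA : a ∉ A := fun h => ha (Finset.mem_powerset.1 hA h)
            rw [markWeight_update_insert r haA, Finset.card_insert_of_notMem haA]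
      _ = binomialMean r (Fintype.card ι - 1) fun k => f (k + 1) := by
          rw [Finset.sum_powerset_apply_card
            fun k => r ^ k * (1 - r) ^ (Fintype.card ι - 1 - k) * f (k + 1), hcard]
          simp only [binomialMean, nsmul_eq_mul, mul_assoc]
  · intro A hA
    have haA : a ∉ A := fun h => ha (Finset.mem_powerset.1 hA h)
    rw [markWeight_eq_zero (Function.update_self a 1 _) haA, zero_mul]

theorem sum_markWeight_mul_inv_card_le {r : ℝ} (hr₀ : 0 < r) (hr₁ : r ≤ 1) (a : ι) {b k : ℝ}
    (hb : 0 ≤ b) (hk : 0 ≤ k) :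
    ∑ T : Finset ι, markWeight (Function.update (fun _ => r) a 1) T *
        (1 + b * (T.card : ℝ)⁻¹ + k * ((T.card : ℝ) ^ 2)⁻¹) ≤
      1 + b * (Fintype.card ι * r)⁻¹ + k * (2 * (Fintype.card ι * r)⁻¹ ^ 2) := by
  obtain ⟨N, hN⟩ := Nat.exists_eq_add_one.2 (Fintype.card_pos_iff.2 ⟨a⟩)
  rw [sum_markWeight_update_mul r a fun m => 1 + b * (m : ℝ)⁻¹ + k * ((m : ℝ) ^ 2)⁻¹, hN]
  simp only [binomialMean_add, binomialMean_const_mul, binomialMean_one, Nat.add_sub_cancel,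
     Nat.cast_add, Nat.cast_one]
  gcongr
  · exact binomialMean_inv_succ_le hr₀ hr₁ N
  · exact binomialMean_inv_succ_sq_le hr₀ hr₁ N

end BinomialMoments

section Taylor

open Topology

theorem eventually_le_quadratic_of_deriv {f f' : ℝ → ℝ} {x₀ f'' B : ℝ}
    (hf : ∀ᶠ x in 𝓝 x₀, HasDerivAt f (f' x) x) (hf' : HasDerivAt f' f'' x₀) (hB : f'' < 2 * B) :
    ∀ᶠ x in 𝓝 x₀, f x ≤ f x₀ + f' x₀ * (x - x₀) + B * (x - x₀) ^ 2 := by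
  set g : ℝ → ℝ := fun x => f x - (f' x₀ * (x - x₀) + B * (x - x₀) ^ 2) with hg
  have hderiv : ∀ᶠ x in 𝓝 x₀, HasDerivAt g (f' x - (f' x₀ + 2 * B * (x - x₀))) x := by
    filter_upwards [hf] with x hx
    have hsub := (hasDerivAt_id x).sub_const x₀
    exact (hx.sub ((hsub.const_mul (f' x₀)).add ((hsub.pow 2).const_mul B))).congr_deriv
      (by simp only [id]; ring)
  have hderiv₂ : HasDerivAt (deriv g) (f'' - 2 * B) x₀ := by
    have hsub := (hasDerivAt_id x₀).sub_const x₀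
    refine ((hf'.sub ((hsub.const_mul (2 * B)).const_add (f' x₀))).congr_deriv
      (by ring)).congr_of_eventuallyEq ?_
    filter_upwards [hderiv] with x hx using hx.deriv
  have hmax : IsLocalMax g x₀ := isLocalMax_of_deriv_deriv_neg
    (by rw [hderiv₂.deriv]; linarith) (by rw [hderiv.self_of_nhds.deriv]; ring)
    hderiv.self_of_nhds.continuousAt
  filter_upwards [hmax] with x hx
  simp only [hg, sub_self] at hx
  linarith

theorem exists_le_mul_abs_pow_of_eventually_nonpos {g : ℝ → ℝ} {s : Set ℝ} (hs : IsCompact s)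
    (hg : ContinuousOn g s) (hg₀ : ∀ᶠ u in 𝓝 0, g u ≤ 0) (m : ℕ) :
    ∃ K, 0 ≤ K ∧ ∀ u ∈ s, g u ≤ K * |u| ^ m := by
  obtain ⟨η, hη, hloc⟩ := Metric.eventually_nhds_iff.1 hg₀
  obtain ⟨C, hC⟩ := hs.exists_bound_of_continuousOn hg
  refine ⟨|C| / η ^ m, by positivity, fun u hu => ?_⟩
  rcases lt_or_ge |u| η with hlt | hge
  · exact (hloc (by simpa using hlt)).trans (by positivity)
  · calc g u ≤ |C| := (le_abs_self _).trans ((hC u hu).trans (le_abs_self C))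
      _ ≤ |C| / η ^ m * |u| ^ m := by
        rw [div_mul_eq_mul_div, le_div_iff₀ (by positivity)]
        gcongr

theorem hasDerivAt_one_add_rpow_mul_one_sub_rpow (p q : ℝ) {x : ℝ} (hx : |x| < 1) :
    HasDerivAt (fun u : ℝ => (1 + u) ^ p * (1 - u) ^ q)
      (p * ((1 + x) ^ (p - 1) * (1 - x) ^ q) - q * ((1 + x) ^ p * (1 - x) ^ (q - 1))) x := by
  have := abs_lt.1 hx
  have hadd := ((hasDerivAt_id x).const_add 1).rpow_const (p := p)
    (Or.inl (by simp only [id]; linarith))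
  have hsub := ((hasDerivAt_id x).const_sub 1).rpow_const (p := q)
    (Or.inl (by simp only [id]; linarith))
  exact (hadd.mul hsub).congr_deriv (by simp only [id]; ring)

theorem eventually_tiltedMoment_le_quadratic {α B : ℝ} (hB : 2 * α * (α - 1) < B) :
    ∀ᶠ u in 𝓝 0, tiltedMoment α u ≤ 1 + (2 * α - 1) * u + B * u ^ 2 := by
  set f' : ℝ → ℝ := fun x => α * ((1 + x) ^ (α - 1) * (1 - x) ^ (1 - α)) -
    (1 - α) * ((1 + x) ^ α * (1 - x) ^ (1 - α - 1)) with hf'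
  have hderiv : ∀ᶠ x in 𝓝 (0 : ℝ), HasDerivAt (tiltedMoment α) (f' x) x := by
    filter_upwards [Metric.ball_mem_nhds (0 : ℝ) one_pos] with x hx
    exact hasDerivAt_one_add_rpow_mul_one_sub_rpow α (1 - α) (by simpa using hx)
  have hderiv₂ : HasDerivAt f' (4 * α * (α - 1)) 0 := by
    have h₁ := (hasDerivAt_one_add_rpow_mul_one_sub_rpow (α - 1) (1 - α) (x := 0)
      (by simp)).const_mul α
    have h₂ := (hasDerivAt_one_add_rpow_mul_one_sub_rpow α (1 - α - 1) (x := 0)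
      (by simp)).const_mul (1 - α)
    exact (h₁.sub h₂).congr_deriv (by simp only [add_zero, sub_zero, Real.one_rpow]; ring)
  have hvalue : tiltedMoment α 0 = 1 := by simp [tiltedMoment]
  have hslope : f' 0 = 2 * α - 1 := by
    simp only [hf', add_zero, sub_zero, Real.one_rpow]
    ring
  simpa only [hvalue, hslope, sub_zero] using
    eventually_le_quadratic_of_deriv hderiv hderiv₂ (by linarith)

theorem exists_tiltedMoment_le_quartic {α B c : ℝ} (hB : 2 * α * (α - 1) < B) (hc : c < 1) :
    ∃ K, 0 ≤ K ∧ ∀ u, |u| ≤ c →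
      tiltedMoment α u ≤ 1 + (2 * α - 1) * u + B * u ^ 2 + K * u ^ 4 := by
  have hcont : ContinuousOn (tiltedMoment α) (Set.Icc (-c) c) := fun u hu =>
    (hasDerivAt_one_add_rpow_mul_one_sub_rpow α (1 - α)
      ((abs_le.2 hu).trans_lt hc)).continuousAt.continuousWithinAt
  obtain ⟨K, hK₀, hK⟩ := exists_le_mul_abs_pow_of_eventually_nonpos
    (g := fun u => tiltedMoment α u - (1 + (2 * α - 1) * u + B * u ^ 2)) isCompact_Icc
    (hcont.sub (by fun_prop))
    ((eventually_tiltedMoment_le_quadratic hB).mono fun u hu => sub_nonpos.2 hu) 4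
  refine ⟨K, hK₀, fun u hu => ?_⟩
  have h := hK u (abs_le.1 hu)
  rw [Even.pow_abs (by decide)] at h
  linarith

end Taylor

section Amplification

/-- The marking probabilities of the shuffled process: `a` is always marked, and every other
record with probability `exp (-ε)`. -/
noncomputable def markProb {n : ℕ} (ε : ℝ) (a : Fin n) : Fin n → ℝ :=
  Function.update (fun _ => Real.exp (-ε)) a 1

theorem markProb_nonneg {n : ℕ} (ε : ℝ) (a j : Fin n) : 0 ≤ markProb ε a j := by
  rcases eq_or_ne j a with rfl | hj
  · simp [markProb]
  · simpa [markProb, hj] using Real.exp_nonneg (-ε)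

theorem markProb_le_one {n : ℕ} {ε : ℝ} (hε : 0 ≤ ε) (a j : Fin n) : markProb ε a j ≤ 1 := by
  rcases eq_or_ne j a with rfl | hj
  · simp [markProb]
  · simpa [markProb, hj] using hε

theorem AdaptiveProcess.IsLocallyDP.exists_shuffledLaw_eq_tiltedMixture {n : ℕ} {D : Type*}
    {S : Fin n → Type*} [∀ i, MeasurableSpace (S i)] {R : AdaptiveProcess n D S} {ε : ℝ}
    (hR : R.IsLocallyDP ε) (hε : 0 ≤ ε) {X Y : Fin n → D} {a : Fin n}
    (hXY : ∀ j, j ≠ a → X j = Y j) :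
    ∃ M : Finset (Fin n) × Equiv.Perm (Fin n) × (Fin n → Bool) → Measure (∀ i, S i),
      (∀ k, IsProbabilityMeasure (M k)) ∧
      R.shuffledLaw X = tiltedMixture (configWeight (markProb ε a))
        (fun k => signBias ε * meanSign k.1 k.2.2) M ∧
      R.shuffledLaw Y = tiltedMixture (configWeight (markProb ε a))
        (-fun k => signBias ε * meanSign k.1 k.2.2) M := by
  have := R.isMarkov
  choose G L hG hL hXa hYa hrecord using fun i =>
    exists_isCloneDecomposition (κ := R.randomizer i) hε (hR i) (X a) (Y a)
  have hbias := abs_signBias_le_one hε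
  have hneg : (-fun k : Finset (Fin n) × Equiv.Perm (Fin n) × (Fin n → Bool) =>
      signBias ε * meanSign k.1 k.2.2) = fun k => -signBias ε * meanSign k.1 k.2.2 :=
    funext fun k => (neg_mul _ _).symm
  rw [hneg]
  refine ⟨fun k => cloneLaw G L X k.1 k.2.1 k.2.2, fun k => inferInstance,
    R.shuffledLaw_eq_tiltedMixture G L X X (markProb_nonneg ε a) (markProb_le_one hε a)
      (Function.update_self ..) hbias fun i j z => ?_,
    R.shuffledLaw_eq_tiltedMixture G L X Y (markProb_nonneg ε a) (markProb_le_one hε a)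
      (Function.update_self ..) ((abs_neg _).trans_le hbias) fun i j z => ?_⟩
  all_goals rcases eq_or_ne j a with rfl | hj
  · simpa only [markProb, Function.update_self, Pi.single_eq_same] using hXa i (X j) z
  · simpa only [markProb, Function.update_of_ne hj, Pi.single_eq_of_ne hj] using hrecord i (X j) z
  · simpa only [markProb, Function.update_self, Pi.single_eq_same] using hYa i (X j) z
  · simpa only [markProb, Function.update_of_ne hj, Pi.single_eq_of_ne hj, ← hXY j hj] using
      hrecord i (X j) z

theorem exists_sum_configWeight_mul_tiltedMoment_le {α c : ℝ} (hα : 1 < α) (hc : |c| < 1) {ε : ℝ}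
    (hε : 0 ≤ ε) :
    ∃ b k, b < 2 * α * (α - 1) ∧ ∀ (n : ℕ) (a : Fin n),
      ∑ q, configWeight (markProb ε a) q * tiltedMoment α (c * meanSign q.1 q.2.2) ≤
        1 + b * (Real.exp ε / n) + k * (Real.exp ε / n) ^ 2 := by
  have hD : 0 < 2 * α * (α - 1) := by nlinarith
  have hc₂ : c ^ 2 < 1 := (sq_lt_one_iff_abs_lt_one c).2 hc
  obtain ⟨B, hDB, hBD⟩ : ∃ B, 2 * α * (α - 1) < B ∧ B * c ^ 2 < 2 * α * (α - 1) :=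
    ⟨2 * α * (α - 1) * (2 - c ^ 2), lt_mul_of_one_lt_right hD (by linarith),
      by nlinarith [mul_pos hD (pow_pos (sub_pos.2 hc₂) 2)]⟩
  have hB : 0 ≤ B := (hD.trans hDB).le
  obtain ⟨K, hK₀, hK⟩ := exists_tiltedMoment_le_quartic hDB hc
  refine ⟨B * c ^ 2, 6 * K * c ^ 4, hBD, fun n a => ?_⟩
  have hr : (n * Real.exp (-ε))⁻¹ = Real.exp ε / n := by
    rw [Real.exp_neg, mul_inv, inv_inv, inv_mul_eq_div]
  rw [sum_configWeight_mul _ fun T s => tiltedMoment α (c * meanSign T s)]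
  calc ∑ T, markWeight (markProb ε a) T * 𝔼 s, tiltedMoment α (c * meanSign T s)
      ≤ ∑ T : Finset (Fin n), markWeight (markProb ε a) T *
          (1 + B * c ^ 2 * (T.card : ℝ)⁻¹ + 3 * K * c ^ 4 * ((T.card : ℝ) ^ 2)⁻¹) := by
        gcongr with T
        · exact markWeight_nonneg (markProb_nonneg ε a) (markProb_le_one hε a) T
        · exact expect_comp_mul_meanSign_le hK₀ hK T
    _ ≤ 1 + B * c ^ 2 * (Real.exp ε / n) + 3 * K * c ^ 4 * (2 * (Real.exp ε / n) ^ 2) := by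
        rw [← hr]
        simpa only [markProb, Fintype.card_fin] using sum_markWeight_mul_inv_card_le
          (Real.exp_pos (-ε)) (Real.exp_le_one_iff.2 (neg_nonpos.2 hε)) a (by positivity)
          (by positivity)
    _ = 1 + B * c ^ 2 * (Real.exp ε / n) + 6 * K * c ^ 4 * (Real.exp ε / n) ^ 2 := by ring

theorem eventually_quadratic_le_exp {b d : ℝ} (hbd : b < d) (k : ℝ) :
    ∀ᶠ x in nhds 0, 0 ≤ x → 1 + b * x + k * x ^ 2 ≤ Real.exp (d * x) := by
  have hlim : Tendsto (fun x => b + k * x) (nhds 0) (nhds b) := by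
    simpa using (Continuous.tendsto (by fun_prop : Continuous fun x => b + k * x) 0)
  filter_upwards [hlim.eventually_le_const hbd] with x hx hx₀
  have := mul_le_mul_of_nonneg_right hx hx₀
  linarith [Real.add_one_le_exp (d * x)]

end Amplification

theorem corollary2_general (ε₀ α : ℝ) (hε₀ : 0 ≤ ε₀) (hα : 1 < α) :
    ∀ᶠ n : ℕ in atTop,
      ∀ (D : Type*) (S : Fin n → Type*) [∀ i, MeasurableSpace (S i)]
        (R : AdaptiveProcess n D S), R.IsLocallyDP ε₀ →
          IsRDP α (2 * Real.exp ε₀ * α / ((n : ℝ) - 1)) R.shuffledLaw := by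
  have hbias : |signBias ε₀| < 1 :=
    (abs_of_nonneg (signBias_nonneg hε₀)).trans_lt (signBias_lt_one ε₀)
  obtain ⟨b, k, hb, hmoment⟩ := exists_sum_configWeight_mul_tiltedMoment_le hα hbias hε₀
  filter_upwards [(tendsto_const_div_atTop_nhds_zero_nat (Real.exp ε₀)).eventually
    (eventually_quadratic_le_exp hb k), eventually_gt_atTop 1] with n hexp hn D S _ R hR X Y hXY
  obtain ⟨a, -, hXY⟩ := hXY
  obtain ⟨M, hM, hX, hY⟩ := hR.exists_shuffledLaw_eq_tiltedMixture hε₀ hXY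
  have hu (q : Finset (Fin n) × Equiv.Perm (Fin n) × (Fin n → Bool)) :
      |signBias ε₀ * meanSign q.1 q.2.2| < 1 := by
    rw [abs_mul]
    exact mul_lt_one_of_nonneg_of_lt_one_left (abs_nonneg _) hbias (abs_meanSign_le_one _ _)
  have hn' : (1 : ℝ) < n := by exact_mod_cast hn
  have hexponent : 2 * α * (α - 1) * (Real.exp ε₀ / n) ≤
      (α - 1) * (2 * Real.exp ε₀ * α / (n - 1)) :=
    calc 2 * α * (α - 1) * (Real.exp ε₀ / n)
        ≤ 2 * α * (α - 1) * (Real.exp ε₀ / (n - 1)) := by gcongr; linarith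
      _ = (α - 1) * (2 * Real.exp ε₀ * α / (n - 1)) := by ring
  have hsum := (hmoment n a).trans ((hexp (by positivity)).trans (Real.exp_le_exp.2 hexponent))
  have hw := configWeight_nonneg (markProb_nonneg ε₀ a) (markProb_le_one hε₀ a)
  rw [hX, hY]
  exact renyiDivergence_le_of_lintegral_le hα (tiltedMixture_absolutelyContinuous _ hu M)
    ((lintegral_rnDeriv_rpow_tiltedMixture_le hα.le hw hu M).trans
      (ENNReal.ofReal_le_ofReal hsum))

theorem corollary2 (ε₀ α : ℝ) (hε₀ : 0 ≤ ε₀) (hα : 2 ≤ α) :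
    ∀ᶠ n : ℕ in atTop,
      ∀ (D : Type*) (S : Fin n → Type*) [∀ i, MeasurableSpace (S i)]
        (R : AdaptiveProcess n D S), R.IsLocallyDP ε₀ →
          IsRDP α (2 * Real.exp ε₀ * α / ((n : ℝ) - 1)) R.shuffledLaw :=
  corollary2_general ε₀ α hε₀ (by linarith)
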